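/- Throughout, $X$ denotes a finite alphabet. A pseudovariety is a class of finite semigroups closed under taking subsemigroups, homomorphic images and finite direct products; $\overline{\Omega}_X\mathsf V$ denotes the free pro-$\mathsf V$ semigroup on $X$, i.e. the inverse limit of the quotients of $X^+$ that belong to $\mathsf V$. A language $L\subseteq X^+$ is $\mathsf V$-recognizable if $L=\varphi^{-1}(P)$ for some homomorphism $\varphi:X^+\to S$ with $S\in\mathsf V$ and some $P\subseteq S$; $\mathsf V$ is closed under concatenation if, for every finite alphabet $X$, the concatenation $KL$ of any two $\mathsf V$-recognizable languages $K,L\subseteq X^+$ is $\mathsf V$-recognizable. Let $\widehat{\mathbb N}$ be the profinite completion of $(\mathbb N,+)$, and for $\alpha\in\widehat{\mathbb N}\setminus\mathbb N$ let $x\mapsto x^\alpha$ be the operation on $\overline{\Omega}_X\mathsf V$ given by $x^\alpha=\lim_{n\to\alpha}x^n$, where $n$ runs over the positive integers. A $\bar u$-word over $\mathsf V$ is an element of the smallest subset of $\overline{\Omega}_X\mathsf V$ that contains $X$ and is closed under multiplication and under all operations $x\mapsto x^\alpha$ with $\alpha\in\widehat{\mathbb N}\setminus\mathbb N$. **Theorem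 2.2.** Let $\mathsf V$ be a pseudovariety of semigroups closed under concatenation. Then $\mathsf V$ is $\bar u$-factorial: for every finite alphabet $X$, whenever $w\in\overline{\Omega}_X\mathsf V$ is a $\bar u$-word over $\mathsf V$ and $w=pvq$ with $v\in\overline{\Omega}_X\mathsf V$ and $p,q\in(\overline{\Omega}_X\mathsf V)^1$ (that is, $p$ and $q$ may be empty), $v$ is also a $\bar u$-word over $\mathsf V$. -/

import Mathlib

open Filter Topology
open scoped Pointwise

universe u

/-- A pseudovariety of semigroups: a class of finite semigroups closed under taking subsemigroups,
homomorphic images and finite direct products (the empty product being the one-element semigroup).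
Both subsemigroups and images are taken up to isomorphism. As in Mathlib, the empty semigroup is
a semigroup; it is a subsemigroup of every semigroup. -/
structure Pseudovariety where
  mem : (S : Type u) → [Semigroup S] → Prop
  finite_of_mem : ∀ (S : Type u) [Semigroup S], mem S → Finite S
  sub_mem : ∀ (S T : Type u) [Semigroup S] [Semigroup T] (f : S →ₙ* T),
    Function.Injective f → mem T → mem S
  quot_mem : ∀ (S T : Type u) [Semigroup S] [Semigroup T] (f : S →ₙ* T),
    Function.Surjective f → mem S → mem T
  unit_mem : mem PUnit.{u + 1}
  prod_mem : ∀ (S T : Type u) [Semigroup S] [Semigroup T], mem S → mem T → mem (S × T)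

namespace Pseudovariety

/-- `L ⊆ X⁺` is `V`-recognizable: it is the inverse image of a subset of a member of `V` under
a homomorphism. These languages form the variety of rational languages corresponding to `V`. -/
def Recognizable (V : Pseudovariety.{u}) {X : Type u} (L : Set (FreeSemigroup X)) : Prop :=
  ∃ (S : Type u) (_ : Semigroup S) (φ : FreeSemigroup X →ₙ* S) (P : Set S),
    V.mem S ∧ L = φ ⁻¹' P

/-- `V` is closed under concatenation: over each finite alphabet, the concatenation product
`K * L = {k * l | k ∈ K, l ∈ L}` of two `V`-recognizable languages is `V`-recognizable. -/
def ClosedUnderConcatenation (V : Pseudovariety.{u}) : Prop :=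
  ∀ (X : Type u) [Finite X] (K L : Set (FreeSemigroup X)),
    V.Recognizable K → V.Recognizable L → V.Recognizable (K * L)

/-- The congruences on `X⁺` whose quotient belongs to `V`. -/
def Cong (V : Pseudovariety.{u}) (X : Type u) : Type u :=
  {c : Con (FreeSemigroup X) // V.mem c.Quotient}

/-- The free pro-`V` semigroup on `X`: the inverse limit of all quotients of `X⁺` that belong
to `V`, along the canonical projections `X⁺/c → X⁺/d` for `c ≤ d`. -/
@[ext]
structure FreePro (V : Pseudovariety.{u}) (X : Type u) : Type u where
  val : ∀ c : V.Cong X, c.1.Quotient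
  compat : ∀ c d : V.Cong X, c.1 ≤ d.1 → ∀ w : FreeSemigroup X,
    val c = (w : c.1.Quotient) → val d = (w : d.1.Quotient)

end Pseudovariety

/-- The profinite completion of the additive monoid of natural numbers: the inverse limit of all
finite quotients of `ℕ`, along the canonical projections. -/
@[ext]
structure NHat : Type where
  val : ∀ c : {c : AddCon ℕ // Finite c.Quotient}, c.1.Quotient
  compat : ∀ c d : {c : AddCon ℕ // Finite c.Quotient}, c.1 ≤ d.1 → ∀ n : ℕ,
    val c = (n : c.1.Quotient) → val d = (n : d.1.Quotient)

namespace NHat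

/-- The canonical map from `ℕ` to its profinite completion. -/
def ofNat (n : ℕ) : NHat where
  val c := (n : c.1.Quotient)
  compat c d h _ hm := (AddCon.eq d.1).2 (h ((AddCon.eq c.1).1 hm))

/-- The topology of the inverse limit of discrete spaces. -/
instance : TopologicalSpace NHat :=
  ⨅ c, TopologicalSpace.induced (fun α : NHat => α.val c) ⊥

/-- `α` is infinite: it does not belong to (the image of) `ℕ`. -/
def Infinite (α : NHat) : Prop := α ∉ Set.range ofNat

/-- The filter of the positive integers `n` that tend to `α` in the profinite completion of `ℕ`. -/
def nhdsPNat (α : NHat) : Filter ℕ+ := comap (fun n : ℕ+ => ofNat n) (𝓝 α)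

theorem eventually_val_eq (α : NHat) (c : {c : AddCon ℕ // Finite c.Quotient}) :
    ∀ᶠ n : ℕ+ in α.nhdsPNat, ((n : ℕ) : c.1.Quotient) = α.val c := by
  let _ : TopologicalSpace c.1.Quotient := ⊥
  have : DiscreteTopology c.1.Quotient := ⟨rfl⟩
  have h : Tendsto (fun β : NHat => β.val c) (𝓝 α) (pure (α.val c)) := by
    have hc : Continuous (fun β : NHat => β.val c) := continuous_iff_le_induced.2 (iInf_le _ c)
    have hc' := hc.tendsto α
    rwa [nhds_discrete c.1.Quotient] at hc'
  have h2 := h.comp (tendsto_comap (f := fun n : ℕ+ => ofNat n) (x := 𝓝 α))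
  exact tendsto_pure.1 h2

end NHat

/-- The power `s ^ n` with positive integer exponent in a semigroup. -/
def Semigroup.ppow {S : Type*} [Semigroup S] (s : S) (n : ℕ+) : S :=
  PNat.recOn n s (fun _ t => t * s)

theorem Semigroup.coe_ppow {S : Type*} [Semigroup S] (s : S) (n : ℕ+) :
    ((Semigroup.ppow s n : S) : WithOne S) = (s : WithOne S) ^ (n : ℕ) := by
  induction n using PNat.recOn with
  | one => simp [Semigroup.ppow]
  | succ n ih =>
    have : Semigroup.ppow s (n + 1) = Semigroup.ppow s n * s := PNat.recOn_succ n _ _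
    rw [this, WithOne.coe_mul, ih, PNat.add_coe, PNat.one_coe, pow_succ]

theorem NHat.nhdsPNat_neBot (α : NHat) (hα : α.Infinite) : α.nhdsPNat.NeBot := by
  classical
  -- the congruence with classes `{0}` and the positive integers
  let z : AddCon ℕ :=
    { r := fun m n => (m = 0 ↔ n = 0)
      iseqv := ⟨fun _ => Iff.rfl, fun h => h.symm, fun h k => h.trans k⟩
      add' := by intro a b c d h k; simp only [Nat.add_eq_zero_iff]; rw [h, k] }
  have fin_inf : ∀ c d : AddCon ℕ, Finite c.Quotient → Finite d.Quotient →
      Finite (c ⊓ d).Quotient := by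
    intro c d hc hd
    refine Finite.of_injective (β := c.Quotient × d.Quotient)
      (fun q => Quotient.liftOn' q (fun n : ℕ => ((n : c.Quotient), (n : d.Quotient)))
        (fun a b h => Prod.ext ((AddCon.eq c).2 h.1) ((AddCon.eq d).2 h.2))) ?_
    intro p q
    induction p using Quotient.inductionOn'
    induction q using Quotient.inductionOn'
    intro h
    exact Quotient.sound' ⟨(AddCon.eq c).1 (Prod.ext_iff.1 h).1, (AddCon.eq d).1 (Prod.ext_iff.1 h).2⟩
  have hz : Finite z.Quotient := by
    refine Finite.of_injective (β := Prop)
      (fun q => Quotient.liftOn' q (fun n : ℕ => n = 0) (fun a b h => propext h)) ?_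
    intro p q
    induction p using Quotient.inductionOn'
    induction q using Quotient.inductionOn'
    intro h
    exact Quotient.sound' (iff_of_eq h)
  have hz0 : α.val ⟨z, hz⟩ ≠ ((0 : ℕ) : z.Quotient) := by
    intro h0
    apply hα
    refine ⟨0, ?_⟩
    ext c
    obtain ⟨n, hn⟩ := Quotient.exists_rep (α.val ⟨c.1 ⊓ z, fin_inf _ _ c.2 hz⟩)
    have h1 := α.compat ⟨c.1 ⊓ z, fin_inf _ _ c.2 hz⟩ c inf_le_left n hn.symm
    have h2 := α.compat ⟨c.1 ⊓ z, fin_inf _ _ c.2 hz⟩ ⟨z, hz⟩ inf_le_right n hn.symm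
    have h3 : n = 0 := ((AddCon.eq z).1 (h2.symm.trans h0)).2 rfl
    subst h3
    exact h1.symm
  -- a positive representative modulo every finite-index congruence
  have key : ∀ c : {c : AddCon ℕ // Finite c.Quotient},
      ∃ n : ℕ+, ((n : ℕ) : c.1.Quotient) = α.val c := by
    intro c
    obtain ⟨n, hn⟩ := Quotient.exists_rep (α.val ⟨c.1 ⊓ z, fin_inf _ _ c.2 hz⟩)
    have h1 := α.compat ⟨c.1 ⊓ z, fin_inf _ _ c.2 hz⟩ c inf_le_left n hn.symm
    have h2 := α.compat ⟨c.1 ⊓ z, fin_inf _ _ c.2 hz⟩ ⟨z, hz⟩ inf_le_right n hn.symm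
    have h3 : n ≠ 0 := by rintro rfl; exact hz0 h2
    exact ⟨⟨n, Nat.pos_of_ne_zero h3⟩, h1.symm⟩
  have fin_all : ∀ s : Finset {c : AddCon ℕ // Finite c.Quotient},
      ∃ e : {c : AddCon ℕ // Finite c.Quotient}, ∀ c ∈ s, e.1 ≤ c.1 := by
    intro s
    induction s using Finset.induction_on with
    | empty => exact ⟨⟨z, hz⟩, by simp⟩
    | insert a s _ ih =>
      obtain ⟨e, he⟩ := ih
      refine ⟨⟨a.1 ⊓ e.1, fin_inf _ _ a.2 e.2⟩, ?_⟩
      intro c hc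
      rcases Finset.mem_insert.1 hc with rfl | hc
      · exact inf_le_left
      · exact inf_le_right.trans (he c hc)
  refine comap_neBot fun t ht => ?_
  rw [nhds_iInf] at ht
  simp only [nhds_induced, @nhds_discrete _ ⊥ ⟨rfl⟩, comap_pure] at ht
  obtain ⟨I, hI, W, hW, rfl⟩ := mem_iInf.1 ht
  obtain ⟨e, he⟩ := fin_all hI.toFinset
  obtain ⟨n, hn⟩ := key e
  refine ⟨n, Set.mem_iInter.2 fun i => ?_⟩
  refine mem_principal.1 (hW i) ?_
  exact (α.compat e i.1 (he i.1 (hI.mem_toFinset.2 i.2)) n hn.symm).symm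

namespace Pseudovariety

namespace FreePro

variable {V : Pseudovariety.{u}} {X : Type u}

instance : Mul (FreePro V X) where
  mul x y :=
    { val := fun c => x.val c * y.val c
      compat := by
        intro c d h w hw
        obtain ⟨a, ha⟩ := Quotient.exists_rep (x.val c)
        obtain ⟨b, hb⟩ := Quotient.exists_rep (y.val c)
        rw [x.compat c d h a ha.symm, y.compat c d h b hb.symm, ← Con.coe_mul]
        rw [← ha, ← hb] at hw
        exact (Con.eq d.1).2 (h ((Con.eq c.1).1 hw)) }

instance : Semigroup (FreePro V X) where
  mul_assoc x y z := FreePro.ext (funext fun c => mul_assoc (x.val c) (y.val c) (z.val c))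

/-- The topology of the inverse limit of discrete spaces. -/
instance : TopologicalSpace (FreePro V X) :=
  ⨅ c, TopologicalSpace.induced (fun x : FreePro V X => x.val c) ⊥

/-- The canonical image of a generator. -/
def of (a : X) : FreePro V X where
  val c := (FreeSemigroup.of a : c.1.Quotient)
  compat c d h _ hw := (Con.eq d.1).2 (h ((Con.eq c.1).1 hw))

theorem ppow_val (x : FreePro V X) (n : ℕ+) (c : V.Cong X) :
    (Semigroup.ppow x n).val c = Semigroup.ppow (x.val c) n := by
  induction n using PNat.recOn with
  | one => rfl
  | succ n ih =>
    have h1 : Semigroup.ppow x (n + 1) = Semigroup.ppow x n * x := PNat.recOn_succ n _ _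
    have h2 : Semigroup.ppow (x.val c) (n + 1) = Semigroup.ppow (x.val c) n * x.val c :=
      PNat.recOn_succ n _ _
    rw [h1, h2, ← ih]
    rfl

theorem exists_tendsto_ppow (x : FreePro V X) (α : NHat) (hα : α.Infinite) :
    ∃ y : FreePro V X, Tendsto (fun n : ℕ+ => Semigroup.ppow x n) α.nhdsPNat (𝓝 y) := by
  have := α.nhdsPNat_neBot hα
  have key : ∀ c : V.Cong X, ∃ q : c.1.Quotient,
      ∀ᶠ n : ℕ+ in α.nhdsPNat, (Semigroup.ppow x n).val c = q := by
    intro c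
    have hfin : Finite c.1.Quotient := V.finite_of_mem _ c.2
    have hfin1 : Finite (WithOne c.1.Quotient) := inferInstanceAs (Finite (Option _))
    let k : AddCon ℕ :=
      { r := fun m n => (x.val c : WithOne c.1.Quotient) ^ m = (x.val c : WithOne c.1.Quotient) ^ n
        iseqv := ⟨fun _ => rfl, fun h => h.symm, fun h k => h.trans k⟩
        add' := by intro a b c d h k; simp only [pow_add]; rw [h, k] }
    have hk : Finite k.Quotient := by
      refine Finite.of_injective (β := WithOne c.1.Quotient)
        (fun q => Quotient.liftOn' q (fun n : ℕ => (x.val c : WithOne c.1.Quotient) ^ n)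
          (fun a b h => h)) ?_
      intro p q
      induction p using Quotient.inductionOn'
      induction q using Quotient.inductionOn'
      intro h
      exact Quotient.sound' h
    have hev := α.eventually_val_eq ⟨k, hk⟩
    obtain ⟨n₀, hn₀⟩ := hev.exists
    refine ⟨Semigroup.ppow (x.val c) n₀, hev.mono fun n hn => ?_⟩
    rw [ppow_val]
    apply WithOne.coe_injective
    rw [Semigroup.coe_ppow, Semigroup.coe_ppow]
    exact (AddCon.eq k).1 (hn.trans hn₀.symm)
  choose q hq using key
  refine ⟨⟨q, fun c d h w hw => ?_⟩, ?_⟩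
  · obtain ⟨n, hc, hd⟩ := ((hq c).and (hq d)).exists
    rw [← hd]
    exact (Semigroup.ppow x n).compat c d h w (hc.trans hw)
  · rw [nhds_iInf, tendsto_iInf]
    intro c
    let _ : TopologicalSpace c.1.Quotient := ⊥
    have : DiscreteTopology c.1.Quotient := ⟨rfl⟩
    rw [nhds_induced, tendsto_comap_iff, nhds_discrete, tendsto_pure]
    exact hq c

/-- The unary operation `x ↦ x ^ α`, for `α` in the profinite completion of `ℕ` but not in `ℕ`:
the limit of the powers `x ^ n` as the positive integer `n` tends to `α`. -/
noncomputable def power (x : FreePro V X) (α : NHat) (hα : α.Infinite) : FreePro V X :=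
  (exists_tendsto_ppow x α hα).choose

theorem tendsto_power (x : FreePro V X) (α : NHat) (hα : α.Infinite) :
    Tendsto (fun n : ℕ+ => Semigroup.ppow x n) α.nhdsPNat (𝓝 (x.power α hα)) :=
  (exists_tendsto_ppow x α hα).choose_spec

/-- The `ū`-words over `V`: the elements of the subalgebra of the free pro-`V` semigroup generated
by `X` under multiplication and all the power operations with infinite exponent. -/
inductive IsUWord : FreePro V X → Prop
  | of (a : X) : IsUWord (of a)
  | mul (x y : FreePro V X) : IsUWord x → IsUWord y → IsUWord (x * y)
  | power (x : FreePro V X) (α : NHat) (hα : α.Infinite) : IsUWord x → IsUWord (x.power α hα)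

end FreePro

/-- `V` is `ū`-factorial: for every finite alphabet `X`, every factor in the free pro-`V` semigroup
on `X` of a `ū`-word is a `ū`-word. Here `v` is a factor of `w` if `w = p v q` for some `p`, `q`
which may be empty, i.e. are taken in the semigroup with an identity adjoined. -/
def IsUFactorial (V : Pseudovariety.{u}) : Prop :=
  ∀ (X : Type u) [Finite X] (v w : FreePro V X), FreePro.IsUWord w →
    (∃ p q : WithOne (FreePro V X), (w : WithOne (FreePro V X)) = p * v * q) →
    FreePro.IsUWord v

end Pseudovariety

/-! Closure under concatenation makes multiplication in the free pro-`V` monoid open: words close to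
a product split into words close to the factors (`exists_append_of_wordClass_eq_mul`). Hence, if `w
= p * v * q`, every word close enough to `w` has an infix close to `v`.

For a `ū`-word `w`, the approximating words may be chosen to follow its construction: a letter, a
concatenation `f ++ f'`, or a finite power of a word `f`. Their infixes are known combinatorially;
an infix of a power of `f` is an infix of `f` or has the form `s f^j r` with `s`, `r` infixes of
`f`. An ultrafilter refining the approximations makes all these pieces converge. Limits of infixes
are factors, to which induction applies, and the limit of `f^j` is a power with exponent in `NHat`
(`WordLim.flatten_replicate_mem`). Pieces may be empty, so the argument runs with an identity
adjoined. -/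

namespace Pseudovariety

/-! ### Congruences with quotient in `V`, and classes of words -/

variable {V : Pseudovariety.{u}} {X : Type u}

instance : Preorder (V.Cong X) := Preorder.lift fun c => c.1

theorem Cong.mem_ker (V : Pseudovariety.{u}) {S : Type u} [Semigroup S] (hS : V.mem S)
    (φ : FreeSemigroup X →ₙ* S) : V.mem (Con.ker φ).Quotient := by
  refine V.sub_mem _ S ⟨fun q => Quotient.liftOn' q φ fun _ _ h => h, ?_⟩ ?_ hS
  · intro p q
    induction p using Quotient.inductionOn'
    induction q using Quotient.inductionOn'
    exact map_mul φ _ _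
  · intro p q
    induction p using Quotient.inductionOn'
    induction q using Quotient.inductionOn'
    exact fun h => Quotient.sound' h

/-- The congruence of words identified by a homomorphism into a member of `V`. -/
def Cong.ker {S : Type u} [Semigroup S] (hS : V.mem S) (φ : FreeSemigroup X →ₙ* S) : V.Cong X :=
  ⟨Con.ker φ, Cong.mem_ker V hS φ⟩

instance : Nonempty (V.Cong X) :=
  ⟨Cong.ker V.unit_mem ⟨fun _ => PUnit.unit, fun _ _ => rfl⟩⟩

theorem Cong.exists_le_le (c d : V.Cong X) : ∃ e : V.Cong X, e ≤ c ∧ e ≤ d := by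
  refine ⟨Cong.ker (V.prod_mem _ _ c.2 d.2) ((Con.mkMulHom c.1).prod (Con.mkMulHom d.1)), ?_, ?_⟩
  · intro a b h
    exact (Con.eq c.1).1 (Prod.ext_iff.1 h).1
  · intro a b h
    exact (Con.eq d.1).1 (Prod.ext_iff.1 h).2

/-- Codirectedness makes `atBot` a proper filter, so some ultrafilter lies below it. -/
instance : IsCodirectedOrder (V.Cong X) :=
  ⟨fun c d => (Cong.exists_le_le c d).imp fun _ h => ⟨h.1, h.2⟩⟩

/-- The homomorphism between quotients given by an inclusion of congruences. -/
def Cong.transition {c d : V.Cong X} (h : c ≤ d) :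
    WithOne c.1.Quotient →* WithOne d.1.Quotient :=
  WithOne.mapMulHom
    { toFun := fun q => Quotient.liftOn' q (fun w => (w : d.1.Quotient))
        fun _ _ hab => (Con.eq d.1).2 (h hab)
      map_mul' := by
        intro p q
        induction p using Quotient.inductionOn'
        induction q using Quotient.inductionOn'
        rfl }

/-- The class of a possibly empty word modulo a congruence. -/
def Cong.wordClass (c : V.Cong X) (l : List X) : WithOne c.1.Quotient :=
  (l.map fun a => (((FreeSemigroup.of a : FreeSemigroup X) : c.1.Quotient) :
    WithOne c.1.Quotient)).prod

@[simp]
theorem Cong.wordClass_append (c : V.Cong X) (l m : List X) :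
    c.wordClass (l ++ m) = c.wordClass l * c.wordClass m := by
  simp [Cong.wordClass]

@[simp]
theorem Cong.wordClass_nil (c : V.Cong X) : c.wordClass ([] : List X) = 1 := rfl

theorem Cong.wordClass_flatten_replicate (c : V.Cong X) (l : List X) (n : ℕ) :
    c.wordClass (List.replicate n l).flatten = c.wordClass l ^ n := by
  induction n with
  | zero => rfl
  | succ n ih => rw [List.replicate_succ, List.flatten_cons, Cong.wordClass_append, ih, pow_succ']

theorem Cong.transition_wordClass {c d : V.Cong X} (h : c ≤ d) (l : List X) :
    Cong.transition h (c.wordClass l) = d.wordClass l := by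
  rw [Cong.wordClass, map_list_prod, List.map_map]
  rfl

theorem Cong.wordClass_cons (c : V.Cong X) (a : X) (l : List X) :
    c.wordClass (a :: l) = (((⟨a, l⟩ : FreeSemigroup X) : c.1.Quotient) :
      WithOne c.1.Quotient) := by
  induction l generalizing a with
  | nil => simp [Cong.wordClass, FreeSemigroup.of]
  | cons b l ih =>
    have h : c.wordClass (a :: b :: l) = c.wordClass [a] * c.wordClass (b :: l) :=
      c.wordClass_append [a] (b :: l)
    rw [h, ih]
    simp only [Cong.wordClass, List.map_cons, List.map_nil, List.prod_singleton]
    rw [← WithOne.coe_mul, ← Con.coe_mul]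
    rfl

theorem Cong.wordClass_head_tail (c : V.Cong X) (w : FreeSemigroup X) :
    c.wordClass (w.head :: w.tail) = ((w : c.1.Quotient) : WithOne c.1.Quotient) :=
  c.wordClass_cons _ _

theorem recognizable_class (c : V.Cong X) (q : c.1.Quotient) :
    V.Recognizable {w : FreeSemigroup X | (w : c.1.Quotient) = q} :=
  ⟨c.1.Quotient, inferInstance, Con.mkMulHom c.1, {q}, c.2, rfl⟩

theorem Recognizable.exists_cong {L : Set (FreeSemigroup X)} (hL : V.Recognizable L) :
    ∃ c : V.Cong X, ∀ v w : FreeSemigroup X, (v : c.1.Quotient) = (w : c.1.Quotient) →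
      v ∈ L → w ∈ L := by
  obtain ⟨S, _, φ, P, hS, rfl⟩ := hL
  refine ⟨Cong.ker hS φ, fun v w h hv => ?_⟩
  have h' : φ v = φ w := (Con.eq _).1 h
  simpa [h'] using hv

/-! ### Projections of the free pro-`V` monoid and openness of multiplication -/

namespace FreePro

theorem exists_rep (x : FreePro V X) (c : V.Cong X) :
    ∃ w : FreeSemigroup X, x.val c = (w : c.1.Quotient) := by
  obtain ⟨w, hw⟩ := Quotient.exists_rep (x.val c)
  exact ⟨w, hw.symm⟩

/-- The canonical projection of the free pro-`V` monoid onto a quotient. -/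
def proj (c : V.Cong X) : WithOne (FreePro V X) →* WithOne c.1.Quotient :=
  WithOne.mapMulHom ⟨fun x => x.val c, fun _ _ => rfl⟩

theorem proj_coe (c : V.Cong X) (x : FreePro V X) :
    proj c (x : WithOne (FreePro V X)) = (x.val c : WithOne c.1.Quotient) := rfl

theorem transition_proj {c d : V.Cong X} (h : c ≤ d) (y : WithOne (FreePro V X)) :
    Cong.transition h (proj c y) = proj d y := by
  induction y with
  | one => simp
  | coe x =>
    obtain ⟨w, hw⟩ := x.exists_rep c
    rw [proj_coe, proj_coe, x.compat c d h w hw, hw]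
    rfl

theorem wordClass_eq_proj_of_le {c d : V.Cong X} (h : c ≤ d) {l : List X}
    {y : WithOne (FreePro V X)} (hl : c.wordClass l = proj c y) : d.wordClass l = proj d y := by
  rw [← Cong.transition_wordClass h, hl, transition_proj]

theorem exists_wordClass_eq_proj (y : WithOne (FreePro V X)) (c : V.Cong X) :
    ∃ l : List X, c.wordClass l = proj c y := by
  induction y with
  | one => exact ⟨[], by simp⟩
  | coe x =>
    obtain ⟨w, hw⟩ := x.exists_rep c
    exact ⟨_, by rw [c.wordClass_head_tail, proj_coe, hw]⟩

theorem proj_injective {y z : WithOne (FreePro V X)} (h : ∀ c : V.Cong X, proj c y = proj c z) :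
    y = z := by
  induction y with
  | one =>
    induction z with
    | one => rfl
    | coe z => exact absurd (h (Classical.arbitrary _)).symm WithOne.coe_ne_one
  | coe y =>
    induction z with
    | one => exact absurd (h (Classical.arbitrary _)) WithOne.coe_ne_one
    | coe z => exact congrArg _ (FreePro.ext (funext fun c => WithOne.coe_injective (h c)))

/-- If `V` is closed under concatenation then the multiplication of the free pro-`V` monoid is
open: words close to a product factorize into words close to the factors. -/
theorem exists_append_of_wordClass_eq_mul [Finite X] (hV : V.ClosedUnderConcatenation)
    (y z : WithOne (FreePro V X)) (c : V.Cong X) :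
    ∃ e ≤ c, ∀ l : List X, e.wordClass l = proj e (y * z) →
      ∃ l₁ l₂, l = l₁ ++ l₂ ∧ c.wordClass l₁ = proj c y ∧ c.wordClass l₂ = proj c z := by
  induction y with
  | one => exact ⟨c, le_rfl, fun l hl => ⟨[], l, rfl, by simp, by simpa using hl⟩⟩
  | coe y =>
  induction z with
  | one => exact ⟨c, le_rfl, fun l hl => ⟨l, [], by simp, by simpa using hl, by simp⟩⟩
  | coe z =>
  -- The words representing `y` modulo `c`, and those representing `z`, form recognizable languages;
  -- some congruence `d` saturates their product.
  obtain ⟨d, hd⟩ := (hV X _ _ (recognizable_class c (y.val c))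
    (recognizable_class c (z.val c))).exists_cong
  obtain ⟨e, hec, hed⟩ := Cong.exists_le_le c d
  refine ⟨e, hec, fun l hl => ?_⟩
  obtain ⟨v, hv⟩ := y.exists_rep e
  obtain ⟨w, hw⟩ := z.exists_rep e
  rw [← WithOne.coe_mul, proj_coe] at hl
  cases l with
  | nil => exact absurd hl.symm WithOne.coe_ne_one
  | cons a l =>
    rw [Cong.wordClass_cons] at hl
    have h1 : ((⟨a, l⟩ : FreeSemigroup X) : e.1.Quotient) = y.val e * z.val e :=
      WithOne.coe_injective hl
    rw [hv, hw, ← Con.coe_mul] at h1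
    -- The product of the representatives lies in the concatenation, so the given word, congruent to
    -- it modulo `d`, does too.
    have h2 := hd (v * w) ⟨a, l⟩ ((Con.eq d.1).2 (hed ((Con.eq e.1).1 h1.symm)))
      (Set.mul_mem_mul (y.compat e c hec v hv).symm (z.compat e c hec w hw).symm)
    obtain ⟨v', hv', w', hw', h⟩ := Set.mem_mul.1 h2
    refine ⟨v'.head :: v'.tail, w'.head :: w'.tail, ?_, ?_, ?_⟩
    · exact (congrArg (fun t : FreeSemigroup X => t.head :: t.tail) h).symm
    · rw [Cong.wordClass_head_tail, proj_coe]
      exact congrArg _ hv'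
    · rw [Cong.wordClass_head_tail, proj_coe]
      exact congrArg _ hw'

theorem exists_infix_of_wordClass_eq_mul [Finite X] (hV : V.ClosedUnderConcatenation)
    (p v q : WithOne (FreePro V X)) (c : V.Cong X) :
    ∃ e ≤ c, ∀ l : List X, e.wordClass l = proj e (p * v * q) →
      ∃ l' , l' <:+: l ∧ c.wordClass l' = proj c v := by
  obtain ⟨d, hdc, hd⟩ := exists_append_of_wordClass_eq_mul hV p v c
  obtain ⟨e, hed, he⟩ := exists_append_of_wordClass_eq_mul hV (p * v) q d
  refine ⟨e, hed.trans hdc, fun l hl => ?_⟩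
  obtain ⟨l₁, l₂, rfl, h, -⟩ := he l hl
  obtain ⟨l₃, l₄, rfl, -, h⟩ := hd l₁ h
  exact ⟨l₄, ⟨l₃, l₂, rfl⟩, h⟩

/-- Convergence of a family of words, along an ultrafilter, to an element of the free pro-`V`
monoid. -/
def WordLim (U : Ultrafilter (V.Cong X)) (f : V.Cong X → List X) (y : WithOne (FreePro V X)) :
    Prop :=
  ∀ d : V.Cong X, ∀ᶠ c in U, d.wordClass (f c) = proj d y

/-! ### Limits of words along an ultrafilter -/

namespace WordLim

variable {U : Ultrafilter (V.Cong X)} {f g : V.Cong X → List X} {y z : WithOne (FreePro V X)}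

theorem unique (hy : WordLim U f y) (hz : WordLim U f z) : y = z :=
  proj_injective fun d =>
    have ⟨_, h1, h2⟩ := ((hy d).and (hz d)).exists
    h1.symm.trans h2

theorem congr' (hy : WordLim U f y) (h : ∀ᶠ c in U, f c = g c) : WordLim U g y := fun d => by
  filter_upwards [hy d, h] with c h1 h2
  rw [← h2, h1]

theorem append (hy : WordLim U f y) (hz : WordLim U g z) :
    WordLim U (fun c => f c ++ g c) (y * z) := fun d => by
  filter_upwards [hy d, hz d] with c h1 h2
  rw [Cong.wordClass_append, h1, h2, map_mul]

theorem of_le (hU : (U : Filter (V.Cong X)) ≤ atBot) {e : V.Cong X → V.Cong X}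
    (he : ∀ c, e c ≤ c) (h : ∀ c, (e c).wordClass (f c) = proj (e c) y) : WordLim U f y :=
  fun d => by
  filter_upwards [hU (eventually_le_atBot d)] with c hc
  exact wordClass_eq_proj_of_le ((he c).trans hc) (h c)

/-- This is compactness: each quotient is finite, so each coordinate is eventually constant along
`U`. A nonempty word never has class `1`, so the coordinates are either all `1` or all in the
semigroup part. -/
theorem exists_lim (U : Ultrafilter (V.Cong X)) (f : V.Cong X → List X) :
    ∃ y, WordLim U f y := by
  have key : ∀ d : V.Cong X, ∃ q, ∀ᶠ c in U, d.wordClass (f c) = q := by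
    intro d
    have : Finite d.1.Quotient := V.finite_of_mem _ d.2
    have : Finite (WithOne d.1.Quotient) := inferInstanceAs (Finite (Option _))
    exact Ultrafilter.eventually_exists_iff.1 (.of_forall fun c => ⟨_, rfl⟩)
  by_cases hf : ∀ᶠ c in U, f c = []
  · refine ⟨1, fun d => ?_⟩
    filter_upwards [hf] with c hc
    simp [hc]
  · rw [← Ultrafilter.eventually_not] at hf
    have key' : ∀ d : V.Cong X, ∃ q : d.1.Quotient, ∀ᶠ c in U,
        d.wordClass (f c) = (q : WithOne d.1.Quotient) := by
      intro d
      obtain ⟨q, hq⟩ := key d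
      obtain ⟨c, hc, hne⟩ := (hq.and hf).exists
      obtain ⟨a, l, hal⟩ := List.exists_cons_of_ne_nil hne
      rw [hal, Cong.wordClass_cons] at hc
      exact ⟨_, hc ▸ hq⟩
    choose q hq using key'
    refine ⟨((⟨q, fun c d h w hw => ?_⟩ : FreePro V X) : WithOne (FreePro V X)), hq⟩
    obtain ⟨b, h1, h2⟩ := ((hq c).and (hq d)).exists
    apply WithOne.coe_injective
    rw [← h2, ← Cong.transition_wordClass h, h1, hw]
    rfl

/-- The words on either side of the infix also have limits along `U`, and these are the cofactors.
-/
theorem exists_factor_of_infix (hz : WordLim U g z) (hy : WordLim U f y)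
    (h : ∀ᶠ c in U, f c <:+: g c) : ∃ p q, z = p * y * q := by
  have h' : ∀ c, ∃ s t, f c <:+: g c → s ++ f c ++ t = g c := by
    intro c
    by_cases hc : f c <:+: g c
    · obtain ⟨s, t, hst⟩ := hc
      exact ⟨s, t, fun _ => hst⟩
    · exact ⟨[], [], fun h => absurd h hc⟩
  choose s t hst using h'
  obtain ⟨p, hp⟩ := exists_lim U s
  obtain ⟨q, hq⟩ := exists_lim U t
  exact ⟨p, q, hz.unique (((hp.append hy).append hq).congr' (h.mono fun c => hst c))⟩

end WordLim

end FreePro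

end Pseudovariety

/-! ### Infixes of powers of a word -/

theorem List.exists_of_suffix_flatten_replicate {α : Type*} {l x : List α} {n : ℕ}
    (h : l <:+ (List.replicate n x).flatten) :
    ∃ s j, s <:+: x ∧ l = s ++ (List.replicate j x).flatten := by
  induction n generalizing l with
  | zero => exact ⟨[], 0, List.nil_infix, by simpa using h⟩
  | succ n ih =>
    rw [List.replicate_succ, List.flatten_cons] at h
    obtain ⟨t, ht⟩ := h
    -- The suffix starts either inside the first copy of `x` or after it.
    rcases List.append_eq_append_iff.1 ht with ⟨s, hs, hl⟩ | ⟨s, hs, hl⟩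
    · exact ⟨s, n, ⟨t, [], by simp [hs]⟩, hl⟩
    · exact ih ⟨s, hl.symm⟩

theorem List.exists_of_infix_flatten_replicate {α : Type*} {l x : List α} {n : ℕ}
    (h : l <:+: (List.replicate n x).flatten) :
    l <:+: x ∨ ∃ s j r, s <:+: x ∧ r <:+: x ∧ l = s ++ (List.replicate j x).flatten ++ r := by
  induction n with
  | zero =>
    left
    obtain rfl : l = [] := by simpa using h
    exact List.nil_infix
  | succ n ih =>
    rw [List.replicate_succ', List.flatten_append, List.flatten_singleton,
      List.infix_append_iff] at h
    rcases h with h | h | ⟨l₁, l₂, rfl, h₁, h₂⟩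
    · exact ih h
    · exact .inl h
    · obtain ⟨s, j, hs, rfl⟩ := List.exists_of_suffix_flatten_replicate h₁
      exact .inr ⟨s, j, l₂, hs, h₂.isInfix, rfl⟩

/-! ### Limits of exponents -/

theorem NHat.exists_ultrafilter_lim {ι : Type*} (U : Ultrafilter ι) (j : ι → ℕ) :
    ∃ β : NHat, ∀ k, ∀ᶠ i in U, ((j i : ℕ) : k.1.Quotient) = β.val k := by
  have key : ∀ k : {c : AddCon ℕ // Finite c.Quotient}, ∃ q : k.1.Quotient,
      ∀ᶠ i in U, ((j i : ℕ) : k.1.Quotient) = q := fun k =>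
    have := k.2
    Ultrafilter.eventually_exists_iff.1 (.of_forall fun i => ⟨_, rfl⟩)
  choose q hq using key
  refine ⟨⟨q, fun c d h n hn => ?_⟩, hq⟩
  obtain ⟨i, h1, h2⟩ := ((hq c).and (hq d)).exists
  rw [← h2]
  exact (AddCon.eq d.1).2 (h ((AddCon.eq c.1).1 (h1.trans hn)))

/-- The congruence identifying exponents which give the same power of an element. -/
def AddCon.powKer {M : Type*} [Monoid M] (a : M) : AddCon ℕ where
  r m n := a ^ m = a ^ n
  iseqv := ⟨fun _ => rfl, fun h => h.symm, fun h k => h.trans k⟩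
  add' := by intro _ _ _ _ h k; simp only [pow_add]; rw [h, k]

theorem AddCon.finite_powKer {M : Type*} [Monoid M] [Finite M] (a : M) :
    Finite (AddCon.powKer a).Quotient := by
  refine Finite.of_injective (β := M)
    (fun q => Quotient.liftOn' q (fun n : ℕ => a ^ n) (fun _ _ h => h)) ?_
  intro p q
  induction p using Quotient.inductionOn'
  induction q using Quotient.inductionOn'
  exact fun h => Quotient.sound' h

/-! ### Factors of `ū`-words -/

namespace Pseudovariety

variable {V : Pseudovariety.{u}} {X : Type u}

namespace FreePro

theorem eventually_power_val_eq (x : FreePro V X) (α : NHat) (hα : α.Infinite) (c : V.Cong X) :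
    ∀ᶠ n : ℕ+ in α.nhdsPNat, proj c ((x.power α hα : FreePro V X) : WithOne (FreePro V X)) =
      proj c (x : WithOne (FreePro V X)) ^ (n : ℕ) := by
  let _ : TopologicalSpace c.1.Quotient := ⊥
  have : DiscreteTopology c.1.Quotient := ⟨rfl⟩
  have hc : Continuous (fun y : FreePro V X => y.val c) := continuous_iff_le_induced.2 (iInf_le _ c)
  have h := (hc.tendsto (x.power α hα)).comp (tendsto_power x α hα)
  rw [nhds_discrete, tendsto_pure] at h
  filter_upwards [h] with n hn
  rw [proj_coe, proj_coe, ← Semigroup.coe_ppow, ← ppow_val, ← hn]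
  rfl

variable (V X) in
/-- The `ū`-words together with the identity. -/
def uWordsOne : Submonoid (WithOne (FreePro V X)) where
  carrier := {y | y = 1 ∨ ∃ x : FreePro V X, y = x ∧ IsUWord x}
  one_mem' := .inl rfl
  mul_mem' := by
    rintro _ _ (rfl | ⟨x, rfl, hx⟩) (rfl | ⟨y, rfl, hy⟩)
    · exact .inl (one_mul 1)
    · exact .inr ⟨y, one_mul _, hy⟩
    · exact .inr ⟨x, mul_one _, hx⟩
    · exact .inr ⟨x * y, (WithOne.coe_mul x y).symm, .mul x y hx hy⟩

theorem coe_mem_uWordsOne {x : FreePro V X} :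
    (x : WithOne (FreePro V X)) ∈ uWordsOne V X ↔ IsUWord x := by
  constructor
  · rintro (h | ⟨y, h, hy⟩)
    · exact absurd h WithOne.coe_ne_one
    · exact WithOne.coe_injective h ▸ hy
  · exact fun h => .inr ⟨x, rfl, h⟩

/-- The exponents `j` tend to some `β` in `NHat`, and in a finite quotient a power depends only on
the residue of its exponent. So `y` is `x ^ β`: an infinite power, or an ordinary one, equal to `1`
when `β` is zero. -/
theorem WordLim.flatten_replicate_mem {U : Ultrafilter (V.Cong X)} {f : V.Cong X → List X}
    {x : FreePro V X} (hf : WordLim U f (x : WithOne (FreePro V X))) (hx : IsUWord x)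
    (j : V.Cong X → ℕ) {y : WithOne (FreePro V X)}
    (hy : WordLim U (fun c => (List.replicate (j c) (f c)).flatten) y) : y ∈ uWordsOne V X := by
  obtain ⟨β, hβ⟩ := NHat.exists_ultrafilter_lim U j
  have hfin : ∀ d : V.Cong X, Finite
      (AddCon.powKer (proj d (x : WithOne (FreePro V X)))).Quotient := fun d =>
    have : Finite d.1.Quotient := V.finite_of_mem _ d.2
    have : Finite (WithOne d.1.Quotient) := inferInstanceAs (Finite (Option _))
    AddCon.finite_powKer _
  have key : ∀ (d : V.Cong X) (n : ℕ),
      (n : (AddCon.powKer (proj d (x : WithOne (FreePro V X)))).Quotient) = β.val ⟨_, hfin d⟩ →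
      proj d y = proj d (x : WithOne (FreePro V X)) ^ n := by
    intro d n hn
    obtain ⟨c, h1, h2, h3⟩ := ((hf d).and ((hy d).and (hβ ⟨_, hfin d⟩))).exists
    rw [← h2, Cong.wordClass_flatten_replicate, h1]
    exact (AddCon.eq (AddCon.powKer _)).1 (h3.trans hn.symm)
  by_cases hinf : β.Infinite
  · have : y = (x.power β hinf : FreePro V X) := proj_injective fun d => by
      have := β.nhdsPNat_neBot hinf
      obtain ⟨n, h1, h2⟩ := ((eventually_power_val_eq x β hinf d).and
        (β.eventually_val_eq ⟨_, hfin d⟩)).exists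
      rw [h1, key d n h2]
    rw [this, coe_mem_uWordsOne]
    exact .power x β hinf hx
  · obtain ⟨n, rfl⟩ := not_not.1 hinf
    have : y = (x : WithOne (FreePro V X)) ^ n := proj_injective fun d => by
      rw [map_pow, key d n rfl]
    rw [this]
    exact pow_mem (coe_mem_uWordsOne.2 hx) n

/-- The factorization is generalized in the induction, because the pieces of `v` are factors of the
components of `w` with new, uncontrolled cofactors. -/
theorem mem_uWordsOne_of_factor [Finite X] (hV : V.ClosedUnderConcatenation) {w : FreePro V X}
    (hw : IsUWord w) (p v q : WithOne (FreePro V X))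
    (h : (w : WithOne (FreePro V X)) = p * v * q) : v ∈ uWordsOne V X := by
  obtain ⟨U, hU⟩ := Ultrafilter.exists_le (atBot : Filter (V.Cong X))
  induction hw generalizing p v q with
  | of a =>
    choose e he hfac using exists_infix_of_wordClass_eq_mul hV p v q
    choose g hg hgv using fun c => hfac c [a] (by rw [← h]; exact (e c).wordClass_cons a [])
    have hv : WordLim U g v := .of_le hU (fun _ => le_rfl) hgv
    have ha : WordLim U (fun _ => [a]) (of a : FreePro V X) := fun d =>
      .of_forall fun _ => d.wordClass_cons a []
    have h1 : (∀ᶠ c in U, g c = []) ∨ ∀ᶠ c in U, g c = [a] :=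
      Ultrafilter.eventually_or.1 (.of_forall fun c => (List.infix_singleton_iff _ _).1 (hg c))
    rcases h1 with h1 | h1
    · have h2 : WordLim U (fun _ => []) v := hv.congr' h1
      rw [h2.unique (z := 1) fun d => .of_forall fun _ => by simp]
      exact one_mem _
    · rw [(hv.congr' h1).unique ha, coe_mem_uWordsOne]
      exact .of a
  | mul x y _ _ ihx ihy =>
    choose e he hfac using exists_infix_of_wordClass_eq_mul hV p v q
    choose f hf using fun c => exists_wordClass_eq_proj (x : WithOne (FreePro V X)) (e c)
    choose f' hf' using fun c => exists_wordClass_eq_proj (y : WithOne (FreePro V X)) (e c)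
    -- Approximating `x` and `y` modulo the finer `e c` makes the concatenation precise enough to
    -- contain an infix representing `v` modulo `c`.
    choose g hg hgv using fun c => hfac c (f c ++ f' c)
      (by rw [Cong.wordClass_append, hf, hf', ← map_mul, ← h, WithOne.coe_mul])
    have hv : WordLim U g v := .of_le hU (fun _ => le_rfl) hgv
    have hx : WordLim U f x := .of_le hU he hf
    have hy : WordLim U f' y := .of_le hU he hf'
    have hcases := Filter.Eventually.of_forall (f := (U : Filter _))
      fun c => List.infix_append_iff.1 (hg c)
    rw [Ultrafilter.eventually_or, Ultrafilter.eventually_or] at hcases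
    rcases hcases with h1 | h1 | h1
    · obtain ⟨p', q', h2⟩ := hx.exists_factor_of_infix hv h1
      exact ihx _ _ _ h2
    · obtain ⟨p', q', h2⟩ := hy.exists_factor_of_infix hv h1
      exact ihy _ _ _ h2
    -- The infix straddles the boundary: its two parts converge to factors of `x` and of `y`.
    · obtain ⟨g₁, h1⟩ := h1.choice
      obtain ⟨g₂, h1⟩ := h1.choice
      obtain ⟨v₁, hv₁⟩ := WordLim.exists_lim U g₁
      obtain ⟨v₂, hv₂⟩ := WordLim.exists_lim U g₂
      obtain ⟨p₁, q₁, h₁⟩ := hx.exists_factor_of_infix hv₁ (h1.mono fun c hc => hc.2.1.isInfix)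
      obtain ⟨p₂, q₂, h₂⟩ := hy.exists_factor_of_infix hv₂ (h1.mono fun c hc => hc.2.2.isInfix)
      rw [(hv.congr' (h1.mono fun c hc => hc.1)).unique (hv₁.append hv₂)]
      exact mul_mem (ihx _ _ _ h₁) (ihy _ _ _ h₂)
  | power x α hα hux ih =>
    choose e he hfac using exists_infix_of_wordClass_eq_mul hV p v q
    choose f hf using fun c => exists_wordClass_eq_proj (x : WithOne (FreePro V X)) (e c)
    have := α.nhdsPNat_neBot hα
    -- Modulo `e c`, the infinite power coincides with a finite power of exponent `m c`.
    choose m hm using fun c => (eventually_power_val_eq x α hα (e c)).exists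
    choose g hg hgv using fun c => hfac c (List.replicate (m c) (f c)).flatten
      (by rw [Cong.wordClass_flatten_replicate, hf, ← h, hm])
    have hv : WordLim U g v := .of_le hU (fun _ => le_rfl) hgv
    have hx : WordLim U f x := .of_le hU he hf
    have hcases := Filter.Eventually.of_forall (f := (U : Filter _))
      fun c => List.exists_of_infix_flatten_replicate (hg c)
    rw [Ultrafilter.eventually_or] at hcases
    rcases hcases with h1 | h1
    · obtain ⟨p', q', h2⟩ := hx.exists_factor_of_infix hv h1
      exact ih _ _ _ h2
    · obtain ⟨s, h1⟩ := h1.choice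
      obtain ⟨j, h1⟩ := h1.choice
      obtain ⟨r, h1⟩ := h1.choice
      obtain ⟨v₁, hv₁⟩ := WordLim.exists_lim U s
      obtain ⟨v₂, hv₂⟩ := WordLim.exists_lim U fun c => (List.replicate (j c) (f c)).flatten
      obtain ⟨v₃, hv₃⟩ := WordLim.exists_lim U r
      obtain ⟨p₁, q₁, h₁⟩ := hx.exists_factor_of_infix hv₁ (h1.mono fun c hc => hc.1)
      obtain ⟨p₃, q₃, h₃⟩ := hx.exists_factor_of_infix hv₃ (h1.mono fun c hc => hc.2.1)
      rw [(hv.congr' (h1.mono fun c hc => hc.2.2)).unique ((hv₁.append hv₂).append hv₃)]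
      exact mul_mem (mul_mem (ih _ _ _ h₁) (hx.flatten_replicate_mem hux j hv₂)) (ih _ _ _ h₃)

end FreePro

end Pseudovariety

theorem theorem2p2 (V : Pseudovariety.{u}) (hV : V.ClosedUnderConcatenation) :
    V.IsUFactorial := by
  rintro X _ v w hw ⟨p, q, h⟩
  exact Pseudovariety.FreePro.coe_mem_uWordsOne.1
    (Pseudovariety.FreePro.mem_uWordsOne_of_factor hV hw p v q h)
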